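/- Let $\mathbb K$ be an algebraically closed field, let $n=d+r$, and let $W\subset\mathbb A^n_{\mathbb K}$ be a smooth complete intersection of codimension $r$: $W=V(f_1,\dots,f_r)$, the vanishing ideal of $W$ is $I_W=\langle f_1,\dots,f_r\rangle\subset\mathbb K[x_1,\dots,x_n]$, the ring $\mathbb K[W]=\mathbb K[x_1,\dots,x_n]/I_W$ has Krull dimension $d$, and every local ring $\mathcal O_{W,p}$, $p\in W$, is regular. Let $M=\left(\partial f_k/\partial x_{d+i}\right)_{1\le k,i\le r}$ be the submatrix of the Jacobian matrix formed by its last $r$ columns, let $h=\det M$, and let $A$ be the cofactor matrix of $M$, normalized so that $A\cdot M=h\cdot E_r$. Put $(\tilde f_1,\dots,\tilde f_r)^T=A\cdot(f_1,\dots,f_r)^T$. Let $f\in\mathbb K[x_1,\dots,x_n]$ be a polynomial with $f\notin I_W$. Suppose that $H_1,\dots,H_d\in\mathbb K[x_1,\dots,x_n]$ are obtained from $f$ by row reduction of the Jacobian matrix of $\tilde f_1,\dots,\tilde f_r,hf$. That is, there are $c_1,\dots,c_r\in\mathbb K[x_1,\dots,x_n]$ such that, for $\tilde f=h f-\sum_{k=1}^r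 c_k\tilde f_k$, $$\left(\frac{\partial\tilde f}{\partial x_1},\dots,\frac{\partial\tilde f}{\partial x_n}\right)=(H_1,\dots,H_d,0,\dots,0)\quad\text{over }\ \mathcal O_W(W\cap D(h))/\langle f\rangle .$$ (For instance, one may take $c_i=\partial f/\partial x_{d+i}$ for $1\le i\le r$ and $H_j=\partial\tilde f/\partial x_j$ for $1\le j\le d$.) Let $\Delta(f)=\langle f,H_1,\dots,H_d\rangle\subset\mathcal O_W(W\cap D(h))$. Let $p=(a_1,\dots,a_n)\in W\cap D(h)$, and let $X_{p,j}\in\mathcal O_{W,p}$ be the image of $x_j-a_j$, for $1\le j\le d$. Then $X_{p,1},\dots,X_{p,d}$ is a regular system of parameters of $\mathcal O_{W,p}$, the continuous homomorphism $\Phi:\mathbb K[[y_1,\dots,y_d]]\to\widehat{\mathcal O_{W,p}}$ with $y_j\mapsto X_{p,j}$ is an isomorphism, and, with $\frac{\partial g}{\partial X_{p,j}}:=\Phi\left(\frac{\partial\Phi^{-1}(g)}{\partial y_j}\right)$ for $g\in\widehat{\mathcal O_{W,p}}$, $$\Delta(f)\,\widehat{\mathcal O_{W,p}}=\left\langle f,\frac{\partial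 f}{\partial X_{p,1}},\dots,\frac{\partial f}{\partial X_{p,d}}\right\rangle\subset\widehat{\mathcal O_{W,p}} .$$ -/

import Mathlib

open MvPolynomial

noncomputable section

namespace ChainRule

section Geometry

variable {K : Type*} [Field K] {n : ℕ}

/-- The coordinate ring `K[W] = K[x₁, …, xₙ] / I_W`, with `I_W` the vanishing ideal of `W`. -/
abbrev CoordRing (W : Set (Fin n → K)) : Type _ :=
  MvPolynomial (Fin n) K ⧸ vanishingIdeal K W

/-- The ring of regular functions `𝒪_W(W ∩ D(h))`: allow powers of `h` as denominators. -/
def RegularFunctions (W : Set (Fin n → K)) (h : MvPolynomial (Fin n) K) : Type _ :=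
  Localization.Away (Ideal.Quotient.mk (vanishingIdeal K W) h)

instance (W : Set (Fin n → K)) (h : MvPolynomial (Fin n) K) : CommRing (RegularFunctions W h) :=
  inferInstanceAs (CommRing (Localization.Away (Ideal.Quotient.mk (vanishingIdeal K W) h)))

instance (W : Set (Fin n → K)) (h : MvPolynomial (Fin n) K) :
    Algebra (CoordRing W) (RegularFunctions W h) :=
  inferInstanceAs (Algebra (CoordRing W)
    (Localization.Away (Ideal.Quotient.mk (vanishingIdeal K W) h)))

instance (W : Set (Fin n → K)) (h : MvPolynomial (Fin n) K) :
    IsLocalization.Away (Ideal.Quotient.mk (vanishingIdeal K W) h) (RegularFunctions W h) :=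
  inferInstanceAs (IsLocalization.Away (Ideal.Quotient.mk (vanishingIdeal K W) h)
    (Localization.Away (Ideal.Quotient.mk (vanishingIdeal K W) h)))

/-- Evaluation of polynomial functions on `W` at a point of `W`. -/
def evalAt (W : Set (Fin n → K)) (p : W) : CoordRing W →+* K :=
  Ideal.Quotient.lift (vanishingIdeal K W) (aeval (p : Fin n → K)).toRingHom
    fun _ hg => hg p p.2

/-- The ideal of all polynomial functions on `W` that vanish at `p`. -/
abbrev pointIdeal (W : Set (Fin n → K)) (p : W) : Ideal (CoordRing W) :=
  RingHom.ker (evalAt W p)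

instance pointIdeal_isPrime (W : Set (Fin n → K)) (p : W) : (pointIdeal W p).IsPrime :=
  RingHom.ker_isPrime (evalAt W p)

/-- The local ring `𝒪_{W,p}`: allow functions not vanishing at `p` as denominators. -/
def LocalRingAt (W : Set (Fin n → K)) (p : W) : Type _ :=
  Localization.AtPrime (pointIdeal W p)

instance (W : Set (Fin n → K)) (p : W) : CommRing (LocalRingAt W p) :=
  inferInstanceAs (CommRing (Localization.AtPrime (pointIdeal W p)))

instance (W : Set (Fin n → K)) (p : W) : Algebra (CoordRing W) (LocalRingAt W p) :=
  inferInstanceAs (Algebra (CoordRing W) (Localization.AtPrime (pointIdeal W p)))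

instance (W : Set (Fin n → K)) (p : W) :
    IsLocalization.AtPrime (LocalRingAt W p) (pointIdeal W p) :=
  inferInstanceAs
    (IsLocalization.AtPrime (Localization.AtPrime (pointIdeal W p)) (pointIdeal W p))

instance (W : Set (Fin n → K)) (p : W) : IsLocalRing (LocalRingAt W p) :=
  IsLocalization.AtPrime.isLocalRing (LocalRingAt W p) (pointIdeal W p)

instance (W : Set (Fin n → K)) (p : W) : Algebra K (LocalRingAt W p) :=
  ((algebraMap (CoordRing W) (LocalRingAt W p)).comp (algebraMap K (CoordRing W))).toAlgebra

instance (W : Set (Fin n → K)) (p : W) : IsScalarTower K (CoordRing W) (LocalRingAt W p) :=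
  IsScalarTower.of_algebraMap_eq' (R := K) (S := CoordRing W) (A := LocalRingAt W p) rfl

/-- The image of a polynomial in `𝒪_W(W ∩ D(h))`. -/
def toRegular (W : Set (Fin n → K)) (h : MvPolynomial (Fin n) K) :
    MvPolynomial (Fin n) K →+* RegularFunctions W h :=
  (algebraMap (CoordRing W) (RegularFunctions W h)).comp (Ideal.Quotient.mk (vanishingIdeal K W))

/-- The image of a polynomial in `𝒪_{W,p}`. -/
def toLocal (W : Set (Fin n → K)) (p : W) : MvPolynomial (Fin n) K →+* LocalRingAt W p :=
  (algebraMap (CoordRing W) (LocalRingAt W p)).comp (Ideal.Quotient.mk (vanishingIdeal K W))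

theorem toLocal_isUnit (W : Set (Fin n → K)) (p : W) (h : MvPolynomial (Fin n) K)
    (hp : aeval (p : Fin n → K) h ≠ 0) :
    IsUnit (algebraMap (CoordRing W) (LocalRingAt W p)
      (Ideal.Quotient.mk (vanishingIdeal K W) h)) := by
  refine IsLocalization.map_units (LocalRingAt W p)
    (⟨_, ?_⟩ : (pointIdeal W p).primeCompl)
  intro hmem
  exact hp (by simpa [evalAt, RingHom.mem_ker] using hmem)

/-- The natural map `𝒪_W(W ∩ D(h)) → 𝒪_{W,p}` for a point `p ∈ W ∩ D(h)`. -/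
def germ (W : Set (Fin n → K)) (h : MvPolynomial (Fin n) K) (p : W)
    (hp : aeval (p : Fin n → K) h ≠ 0) : RegularFunctions W h →+* LocalRingAt W p :=
  IsLocalization.Away.lift (Ideal.Quotient.mk (vanishingIdeal K W) h) (toLocal_isUnit W p h hp)

/-- The image of `x_j - a_j` in the maximal ideal of `𝒪_{W,p}`, where `p = (a₁, …, aₙ)`. -/
def coordGerm (W : Set (Fin n → K)) (p : W) (j : Fin n) :
    IsLocalRing.maximalIdeal (LocalRingAt W p) :=
  ⟨toLocal W p (X j - C ((p : Fin n → K) j)), by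
    refine (IsLocalization.AtPrime.to_map_mem_maximal_iff _ (pointIdeal W p) _).2 ?_
    simp [evalAt, RingHom.mem_ker]⟩

end Geometry

section Completion

variable {K O ι : Type*} [Field K] [CommRing O] [IsLocalRing O] [Algebra K O]

/-- The `𝔪`-adic completion of a local ring. -/
abbrev Completion (O : Type*) [CommRing O] [IsLocalRing O] : Type _ :=
  AdicCompletion (IsLocalRing.maximalIdeal O) O

/-- A regular system of parameters of a regular local ring: a minimal family of generators of the
maximal ideal. -/
structure IsRegularSystemOfParameters [Fintype ι] (x : ι → IsLocalRing.maximalIdeal O) : Prop where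
  isRegularLocalRing : IsRegularLocalRing O
  span_eq : Ideal.span (Set.range fun i => (x i : O)) = IsLocalRing.maximalIdeal O
  card_eq : (IsLocalRing.maximalIdeal O).spanFinrank = Fintype.card ι

theorem idealOfVars_pow_le (x : ι → IsLocalRing.maximalIdeal O) (k : ℕ) :
    idealOfVars ι K ^ k ≤
      (IsLocalRing.maximalIdeal O ^ k).comap (aeval (R := K) fun i => (x i : O)) := by
  refine le_trans (Ideal.pow_right_mono ?_ k) (Ideal.le_comap_pow _ k)
  rw [idealOfVars, Ideal.span_le]
  rintro _ ⟨i, rfl⟩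
  simp

variable [Fintype ι]

variable (K) in
/-- The map `K[[y]] → 𝒪 / 𝔪ᵏ` that truncates a power series below total degree `k` and substitutes
`x i` for `y i`. -/
def cohenMapMod (x : ι → IsLocalRing.maximalIdeal O) (k : ℕ) :
    MvPowerSeries ι K →+* O ⧸ IsLocalRing.maximalIdeal O ^ k :=
  (Ideal.quotientMap (IsLocalRing.maximalIdeal O ^ k) (aeval (R := K) fun i => (x i : O)).toRingHom
    (idealOfVars_pow_le x k)).comp (MvPowerSeries.truncTotalAlgHom ι K k).toRingHom

theorem cohenMapMod_apply (x : ι → IsLocalRing.maximalIdeal O) (k : ℕ) (F : MvPowerSeries ι K) :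
    cohenMapMod K x k F = Ideal.Quotient.mk _ (aeval (fun i => (x i : O)) (F.truncTotal k)) := by
  rfl

theorem cohenMapMod_compat (x : ι → IsLocalRing.maximalIdeal O) {k l : ℕ} (hkl : k ≤ l) :
    (Ideal.Quotient.factorPow (IsLocalRing.maximalIdeal O) hkl).comp (cohenMapMod K x l) =
      cohenMapMod K x k := by
  ext1 F
  simp only [RingHom.comp_apply, cohenMapMod_apply]
  erw [Ideal.Quotient.factor_mk]
  rw [Ideal.Quotient.mk_eq_mk_iff_sub_mem, ← map_sub]
  exact idealOfVars_pow_le x k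
    (MvPowerSeries.truncTotal_sub_truncTotal_mem_pow_idealOfVars hkl le_rfl F)

variable (K) in
/-- The continuous homomorphism `Φ : K[[y]] → 𝒪^` with `Φ (y i) = x i`: a power series is mapped to
the limit of the values of its truncations at `x`. -/
def cohenMap (x : ι → IsLocalRing.maximalIdeal O) : MvPowerSeries ι K →+* Completion O :=
  AdicCompletion.liftRingHom (IsLocalRing.maximalIdeal O) (cohenMapMod K x)
    (cohenMapMod_compat x)

variable (K) in
/-- The partial derivative `∂g/∂x_j = Φ (∂(Φ⁻¹ g)/∂y_j)` on the completion; it is meaningful when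
`Φ = cohenMap K x` is bijective. -/
def completionDeriv (x : ι → IsLocalRing.maximalIdeal O) (j : ι) (g : Completion O) :
    Completion O :=
  cohenMap K x (MvPowerSeries.pderiv K j (Function.invFun (cohenMap K x) g))

variable (K) in
/-- The ideal `⟨g, ∂g/∂x_1, …, ∂g/∂x_d⟩` of the completion. -/
def localDelta (x : ι → IsLocalRing.maximalIdeal O) (g : Completion O) : Ideal (Completion O) :=
  Ideal.span ({g} ∪ Set.range fun j => completionDeriv K x j g)

end Completion

section Construction

variable {K : Type*} [Field K] {d r : ℕ}

/-- `W ⊆ 𝔸^{d+r}` is a smooth complete intersection of codimension `r` whose vanishing ideal is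
generated by `F₁, …, F_r`. -/
structure IsSmoothCompleteIntersection (W : Set (Fin (d + r) → K))
    (F : Fin r → MvPolynomial (Fin (d + r)) K) : Prop where
  isZeroLocus : W = zeroLocus K (Ideal.span (Set.range F))
  vanishingIdeal_eq : vanishingIdeal K W = Ideal.span (Set.range F)
  dim_eq : ringKrullDim (CoordRing W) = d
  smooth : ∀ p : W, IsRegularLocalRing (LocalRingAt W p)

/-- The submatrix `M` of the Jacobian matrix of `F₁, …, F_r` given by the last `r` columns. -/
def jacobianBlock (F : Fin r → MvPolynomial (Fin (d + r)) K) :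
    Matrix (Fin r) (Fin r) (MvPolynomial (Fin (d + r)) K) :=
  Matrix.of fun k i => pderiv (Fin.natAdd d i) (F k)

/-- The minor `h = det M`. -/
def minor (F : Fin r → MvPolynomial (Fin (d + r)) K) : MvPolynomial (Fin (d + r)) K :=
  (jacobianBlock F).det

/-- The vector `A · (F₁, …, F_r)ᵀ`, where `A` is the matrix of cofactors of `M`, normalized by
`A * M = h • 1`. -/
def tildeF (F : Fin r → MvPolynomial (Fin (d + r)) K) : Fin r → MvPolynomial (Fin (d + r)) K :=
  (jacobianBlock F).adjugate.mulVec F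

/-- The polynomial `f~ = h f - ∑ c_k F~_k`. -/
def tildef (F : Fin r → MvPolynomial (Fin (d + r)) K) (f : MvPolynomial (Fin (d + r)) K)
    (c : Fin r → MvPolynomial (Fin (d + r)) K) : MvPolynomial (Fin (d + r)) K :=
  minor F * f - ∑ k, c k * tildeF F k

/-- The image of a polynomial in `𝒪_W(W ∩ D(h)) / ⟨f⟩`. -/
def toRegularMod (W : Set (Fin (d + r) → K)) (h f : MvPolynomial (Fin (d + r)) K) :
    MvPolynomial (Fin (d + r)) K →+* RegularFunctions W h ⧸ Ideal.span {toRegular W h f} :=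
  (Ideal.Quotient.mk (Ideal.span {toRegular W h f})).comp (toRegular W h)

/-- The polynomials `H₁, …, H_d` are obtained from `f` by row operations with multipliers
`c₁, …, c_r`: over `𝒪_W(W ∩ D(h)) / ⟨f⟩`, the gradient of `f~ = h f - ∑ c_k F~_k` is
`(H₁, …, H_d, 0, …, 0)`. -/
structure IsRowReduction (W : Set (Fin (d + r) → K)) (F : Fin r → MvPolynomial (Fin (d + r)) K)
    (f : MvPolynomial (Fin (d + r)) K) (c : Fin r → MvPolynomial (Fin (d + r)) K)
    (H : Fin d → MvPolynomial (Fin (d + r)) K) : Prop where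
  left : ∀ j : Fin d, toRegularMod W (minor F) f (pderiv (Fin.castAdd r j) (tildef F f c)) =
    toRegularMod W (minor F) f (H j)
  right : ∀ i : Fin r, toRegularMod W (minor F) f (pderiv (Fin.natAdd d i) (tildef F f c)) = 0

/-- The row operations can be carried out, with multipliers `c_i = ∂f/∂x_{d+i}`. -/
theorem exists_isRowReduction (W : Set (Fin (d + r) → K))
    (F : Fin r → MvPolynomial (Fin (d + r)) K)
    (hW : vanishingIdeal K W = Ideal.span (Set.range F)) (f : MvPolynomial (Fin (d + r)) K) :
    IsRowReduction W F f (fun i => pderiv (Fin.natAdd d i) f)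
      (fun j => pderiv (Fin.castAdd r j) (tildef F f fun i => pderiv (Fin.natAdd d i) f)) := by
  refine ⟨fun j => rfl, fun i => ?_⟩
  set φ := toRegularMod W (minor F) f with hφ
  have hF : ∀ k, φ (F k) = 0 := by
    intro k
    have : Ideal.Quotient.mk (vanishingIdeal K W) (F k) = 0 := by
      rw [Ideal.Quotient.eq_zero_iff_mem, hW]
      exact Ideal.subset_span ⟨k, rfl⟩
    have h0 : toRegular W (minor F) (F k) = 0 :=
      (congrArg (algebraMap (CoordRing W) (RegularFunctions W (minor F))) this).trans (map_zero _)
    rw [hφ, toRegularMod, RingHom.comp_apply, h0, map_zero]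
  have hf : φ f = 0 := by
    rw [hφ, toRegularMod, RingHom.comp_apply, Ideal.Quotient.eq_zero_iff_mem]
    exact Ideal.subset_span rfl
  have hT : ∀ k, φ (tildeF F k) = 0 := by
    intro k
    simp [tildeF, Matrix.mulVec, dotProduct, hF]
  have hD : ∀ k, φ (pderiv (Fin.natAdd d i) (tildeF F k)) = φ (if k = i then minor F else 0) := by
    intro k
    have h1 : ((jacobianBlock F).adjugate * jacobianBlock F) k i = if k = i then minor F else 0 := by
      rw [Matrix.adjugate_mul]
      simp [Matrix.one_apply, minor]
    rw [← h1, Matrix.mul_apply]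
    simp [tildeF, Matrix.mulVec, dotProduct, hF, jacobianBlock, Derivation.leibniz]
  simp [tildef, Derivation.leibniz, hf, hT, hD, mul_comm, apply_ite φ]

/-- The ideal `Δ(f) = ⟨f, H₁, …, H_d⟩` of `𝒪_W(W ∩ D(h))`. -/
def delta (W : Set (Fin (d + r) → K)) (h f : MvPolynomial (Fin (d + r)) K)
    (H : Fin d → MvPolynomial (Fin (d + r)) K) : Ideal (RegularFunctions W h) :=
  Ideal.span ({toRegular W h f} ∪ Set.range fun j => toRegular W h (H j))

/-- The elements `X_{p,j}` of `𝒪_{W,p}` induced by `x_j - a_j`, for `1 ≤ j ≤ d`. -/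
def inducedParameters (W : Set (Fin (d + r) → K)) (p : W) :
    Fin d → IsLocalRing.maximalIdeal (LocalRingAt W p) :=
  fun j => coordGerm W p (Fin.castAdd r j)

end Construction

end ChainRule

end

noncomputable section

namespace ChainRule

/-! ### First order Taylor expansion of polynomials modulo ideals. -/

section Taylor

variable {R A σ : Type*} [CommRing R] [CommRing A] [Algebra R A]

/-! Since `h(p) ≠ 0`, the Jacobian block `M(p)` is invertible, and this works as an implicit
function theorem. Expanding `F_k = 0` to first order in the local ring expresses the last `r`
coordinates through the first `d` modulo `𝔪²`, so Nakayama shows that the `X_{p,j}` generate `𝔪`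
(`span_inducedParameters`). Conversely, Newton iteration solves `F = 0` modulo any power of `⟨y⟩`
with the first `d` coordinates free. This gives ring maps `𝒪_{W,p} → K[y]/⟨y⟩^k` with `X_{p,j} ↦
y_j`, so a polynomial in the `X_{p,j}` lies in `𝔪^k` only for the obvious reason
(`mem_pow_idealOfVars_of_aeval_mem`). Together with the residue field being `K`, these two facts
make `Φ` bijective and the generators minimal.

For the ideals, write `D_j` for `∂/∂X_{p,j}` and apply the chain rule to `f~`, which equals `h f` on
`W`. Modulo `f`, the left side is `h D_j f`; on the right the row reduction kills the partials in
the last `r` variables and leaves `H_j`. Hence `h D_j f ≡ H_j` modulo `f`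
(`minor_mul_completionDeriv_sub_mem`), and `h` is a unit at `p`. -/

theorem aeval_sub_aeval_mem (J : Ideal A) {v w : σ → A} (h : ∀ i, v i - w i ∈ J)
    (g : MvPolynomial σ R) : aeval v g - aeval w g ∈ J := by
  induction g using MvPolynomial.induction_on with
  | C a => simp
  | add p q hp hq =>
    have := J.add_mem hp hq
    rw [map_add, map_add]
    convert this using 1
    ring
  | mul_X p i hp =>
    have := J.add_mem (J.mul_mem_right (v i) hp) (J.mul_mem_left (aeval w p) (h i))
    rw [map_mul, map_mul, aeval_X, aeval_X]
    convert this using 1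
    ring

/-- First order Taylor expansion of a polynomial, with remainder in `J²`. -/
theorem aeval_add_sub_linear_mem [Fintype σ] (J : Ideal A) (v : σ → A) {δ : σ → A}
    (h : ∀ i, δ i ∈ J) (g : MvPolynomial σ R) :
    aeval (fun i => v i + δ i) g - (aeval v g + ∑ i, δ i * aeval v (pderiv i g)) ∈ J ^ 2 := by
  classical
  induction g using MvPolynomial.induction_on with
  | C a => simp
  | add p q hp hq =>
    have := (J ^ 2).add_mem hp hq
    simp only [map_add, mul_add, Finset.sum_add_distrib]
    convert this using 1
    ring
  | mul_X p j hp =>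
    have h1 : aeval (fun i => v i + δ i) p - aeval v p ∈ J :=
      aeval_sub_aeval_mem J (fun i => by simpa using h i) p
    -- The new error is the old one times `v j`, plus `δ j * (p(v + δ) - p(v))`, a product of two
    -- elements of `J`.
    have h2 := (J ^ 2).add_mem (Ideal.mul_mem_right (v j) _ hp)
      (by rw [pow_two]; exact Ideal.mul_mem_mul (h j) h1)
    have h3 : ∑ i, δ i * aeval v (pderiv i (p * X j)) =
        (∑ i, δ i * aeval v (pderiv i p)) * v j + δ j * aeval v p := by
      have h4 : ∀ i, δ i * aeval v (pderiv i (p * X j)) =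
          δ i * aeval v (pderiv i p) * v j + (if j = i then δ i * aeval v p else 0) := by
        intro i
        rw [Derivation.leibniz, pderiv_X]
        simp only [smul_eq_mul, map_add, map_mul, aeval_X, Pi.single_apply]
        split_ifs <;> simp <;> ring
      rw [Finset.sum_congr rfl fun i _ => h4 i, Finset.sum_add_distrib, Finset.sum_mul]
      simp
    rw [h3]
    simp only [map_mul, aeval_X]
    convert h2 using 1
    ring

end Taylor

/-! ### When substitution of parameters identifies power series with the completion. -/

section Complete

variable {K O ι : Type*} [Field K] [CommRing O] [IsLocalRing O] [Algebra K O]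
  {x : ι → IsLocalRing.maximalIdeal O}

/-- Approximation improves one order at a time: `𝔪^k` is spanned over `O` by polynomials in `x`
lying in the `k`-th power, and replacing a coefficient by its residue in `K` costs a factor in `𝔪`.
-/
theorem exists_aeval_sub_mem
    (hspan : Ideal.span (Set.range fun i => (x i : O)) = IsLocalRing.maximalIdeal O)
    (hres : ∀ o : O, ∃ a : K, o - algebraMap K O a ∈ IsLocalRing.maximalIdeal O) (k : ℕ) (o : O) :
    ∃ P : MvPolynomial ι K,
      o - aeval (fun i => (x i : O)) P ∈ IsLocalRing.maximalIdeal O ^ k := by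
  have key : ∀ k, ∀ o ∈ IsLocalRing.maximalIdeal O ^ k, ∃ P : MvPolynomial ι K,
      o - aeval (fun i => (x i : O)) P ∈ IsLocalRing.maximalIdeal O ^ (k + 1) := by
    intro k o ho
    have hm : IsLocalRing.maximalIdeal O ^ k =
        ((idealOfVars ι K) ^ k).map (aeval (R := K) fun i => (x i : O)) := by
      rw [Ideal.map_pow, idealOfVars, Ideal.map_span, ← Set.range_comp]
      simp [Function.comp_def, hspan]
    rw [hm, Ideal.map] at ho
    induction ho using Submodule.span_induction with
    | mem y hy =>
      obtain ⟨P, -, rfl⟩ := hy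
      exact ⟨P, by simp⟩
    | zero => exact ⟨0, by simp⟩
    | add y z _ _ hy hz =>
      obtain ⟨P, hP⟩ := hy
      obtain ⟨Q, hQ⟩ := hz
      refine ⟨P + Q, ?_⟩
      have := add_mem hP hQ
      rw [map_add]
      convert this using 1
      ring
    | smul a y hy0 hy =>
      obtain ⟨P, hP⟩ := hy
      obtain ⟨c, hc⟩ := hres a
      have hy1 : y ∈ IsLocalRing.maximalIdeal O ^ k := by rw [hm]; exact hy0
      refine ⟨C c * P, ?_⟩
      have := add_mem (Ideal.mul_mem_mul hc hy1)
        (by rw [mul_comm, ← pow_succ]; exact Ideal.mul_mem_left _ (algebraMap K O c) hP :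
          algebraMap K O c * _ ∈ IsLocalRing.maximalIdeal O * IsLocalRing.maximalIdeal O ^ k)
      rw [mul_comm (IsLocalRing.maximalIdeal O), ← pow_succ] at this
      rw [map_mul, aeval_C, smul_eq_mul]
      convert this using 1
      ring
  induction k with
  | zero => exact ⟨0, by simp⟩
  | succ k ih =>
    obtain ⟨P, hP⟩ := ih
    obtain ⟨Q, hQ⟩ := key k _ hP
    exact ⟨P + Q, by rw [map_add, ← sub_sub]; exact hQ⟩

variable [Fintype ι]

theorem evalₐ_cohenMap (k : ℕ) (G : MvPowerSeries ι K) :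
    AdicCompletion.evalₐ (IsLocalRing.maximalIdeal O) k (cohenMap K x G) =
      Ideal.Quotient.mk _ (aeval (fun i => (x i : O)) (G.truncTotal k)) := by
  rw [cohenMap, AdicCompletion.evalₐ_liftRingHom, cohenMapMod_apply]

theorem cohenMap_coe (P : MvPolynomial ι K) :
    cohenMap K x P = algebraMap O (Completion O) (aeval (fun i => (x i : O)) P) := by
  refine AdicCompletion.ext_evalₐ fun k => ?_
  rw [evalₐ_cohenMap, AlgHom.commutes, Ideal.Quotient.algebraMap_eq, Ideal.Quotient.eq, ← map_sub]
  refine idealOfVars_pow_le x k ((mem_pow_idealOfVars_iff' _ _).2 fun m hm => ?_)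
  simp [MvPowerSeries.coeff_truncTotal _ hm]

/-- Under `hinj`, a series in the kernel has every truncation in the corresponding power of the
variable ideal, hence no nonzero coefficient. -/
theorem cohenMap_injective
    (hinj : ∀ k (P : MvPolynomial ι K), aeval (fun i => (x i : O)) P ∈
      IsLocalRing.maximalIdeal O ^ k → P ∈ idealOfVars ι K ^ k) :
    Function.Injective (cohenMap K x) := by
  rw [injective_iff_map_eq_zero]
  intro G hG
  ext m
  -- Truncation keeps degrees strictly below the bound, so `m.degree + 1` is the first order that
  -- sees `m`.
  have h := evalₐ_cohenMap (x := x) (m.degree + 1) G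
  rw [hG, map_zero, eq_comm, Ideal.Quotient.eq_zero_iff_mem] at h
  have := (mem_pow_idealOfVars_iff' _ _).1 (hinj _ _ h) m (Nat.lt_succ_self _)
  rwa [MvPowerSeries.coeff_truncTotal _ (Nat.lt_succ_self _)] at this

theorem cohenMap_surjective
    (hspan : Ideal.span (Set.range fun i => (x i : O)) = IsLocalRing.maximalIdeal O)
    (hres : ∀ o : O, ∃ a : K, o - algebraMap K O a ∈ IsLocalRing.maximalIdeal O)
    (hinj : ∀ k (P : MvPolynomial ι K), aeval (fun i => (x i : O)) P ∈
      IsLocalRing.maximalIdeal O ^ k → P ∈ idealOfVars ι K ^ k) :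
    Function.Surjective (cohenMap K x) := by
  intro g
  induction g using AdicCompletion.induction_on with
  | _ s =>
  choose P hP using fun k => exists_aeval_sub_mem (K := K) hspan hres k (s k)
  -- Both polynomials approximate `s k` modulo `𝔪^k`; `hinj` turns this into the Cauchy property for
  -- the polynomials themselves.
  have hcompat : ∀ {k l : ℕ}, k ≤ l → P l - P k ∈ idealOfVars ι K ^ k := by
    intro k l hkl
    refine hinj k _ ?_
    have h1 := Ideal.Quotient.eq.1 (AdicCompletion.Ideal.mk_eq_mk _ hkl s)
    have h2 := Ideal.pow_le_pow_right hkl (hP l)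
    have := add_mem (sub_mem h1 h2) (hP k)
    rw [map_sub]
    convert this using 1
    change _ = (s l - s k) - (s l - _) + _
    ring
  -- By `hcompat`, the coefficient of `m` is the same in all `P l` with `l > m.degree`.
  let G : MvPowerSeries ι K := fun m => (P (m.degree + 1)).coeff m
  have hG : ∀ m, MvPowerSeries.coeff m G = (P (m.degree + 1)).coeff m := fun m => rfl
  refine ⟨G, AdicCompletion.ext_evalₐ fun k => ?_⟩
  rw [evalₐ_cohenMap, AdicCompletion.evalₐ_mk, eq_comm, Ideal.Quotient.eq]
  have h1 : P k - G.truncTotal k ∈ idealOfVars ι K ^ k := by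
    refine (mem_pow_idealOfVars_iff' _ _).2 fun m hm => ?_
    rw [coeff_sub, MvPowerSeries.coeff_truncTotal _ hm, hG]
    simpa using (mem_pow_idealOfVars_iff' _ _).1 (hcompat (Nat.succ_le_of_lt hm)) m
      (Nat.lt_succ_self _)
  have := add_mem (hP k) (idealOfVars_pow_le x k h1)
  rw [map_sub] at this
  simpa using this

/-- The lower bound is linear independence in the cotangent space: a relation, lifted to
coefficients in `K`, is a linear form whose value lies in `𝔪²`, so by `hinj` the form has no linear
part. -/
theorem spanFinrank_maximalIdeal_eq_card [IsNoetherianRing O]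
    (hspan : Ideal.span (Set.range fun i => (x i : O)) = IsLocalRing.maximalIdeal O)
    (hres : ∀ o : O, ∃ a : K, o - algebraMap K O a ∈ IsLocalRing.maximalIdeal O)
    (hinj : ∀ P : MvPolynomial ι K, aeval (fun i => (x i : O)) P ∈
      IsLocalRing.maximalIdeal O ^ 2 → P ∈ idealOfVars ι K ^ 2) :
    (IsLocalRing.maximalIdeal O).spanFinrank = Fintype.card ι := by
  classical
  refine le_antisymm ?_ ?_
  · rw [← hspan]
    refine (Submodule.spanFinrank_span_le_ncard_of_finite (Set.finite_range _)).trans ?_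
    rw [← Nat.card_coe_set_eq, ← Nat.card_eq_fintype_card]
    exact Finite.card_range_le _
  · rw [IsLocalRing.spanFinrank_maximalIdeal_eq_finrank_cotangentSpace]
    refine LinearIndependent.fintype_card_le_finrank
      (b := fun i => (IsLocalRing.maximalIdeal O).toCotangent (x i)) ?_
    rw [Fintype.linearIndependent_iff]
    intro g hg i
    have hc : ∀ i, ∃ a : K, IsLocalRing.residue O (algebraMap K O a) = g i := by
      intro i
      obtain ⟨o, ho⟩ := IsLocalRing.residue_surjective (g i)
      obtain ⟨a, ha⟩ := hres o
      refine ⟨a, ?_⟩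
      rw [← ho]
      exact ((Ideal.Quotient.eq).2 ha).symm
    choose a ha using hc
    have h1 : (IsLocalRing.maximalIdeal O).toCotangent (∑ i, algebraMap K O (a i) • x i) = 0 := by
      rw [map_sum, ← hg]
      refine Finset.sum_congr rfl fun i _ => ?_
      rw [map_smul, ← ha]
      rfl
    rw [Ideal.toCotangent_eq_zero] at h1
    have h2 := hinj (∑ i, C (a i) * X i) (by simpa [Algebra.smul_def] using h1)
    have h3 := (mem_pow_idealOfVars_iff' _ _).1 h2 (Finsupp.single i 1) (by simp)
    rw [← ha]
    have h4 : a i = 0 := by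
      simpa [coeff_sum, coeff_C_mul, coeff_X, Finsupp.single_left_inj] using h3
    simp [h4]

end Complete

/-- Lets a matrix of constants and its inverse cancel on a vector over a larger ring; it serves both
the Nakayama argument and the Newton step. -/
theorem sum_sum_mul_eq_of_mul_eq_one {K A κ : Type*} [CommRing K] [CommRing A] [Fintype κ]
    [DecidableEq κ] (φ : K →+* A) {M N : Matrix κ κ K} (h : M * N = 1) (t : κ → A) (l : κ) :
    ∑ i, (∑ k, t k * φ (N i k)) * φ (M l i) = t l := by
  have h1 : ∀ k, ∑ i, t k * φ (N i k) * φ (M l i) = if l = k then t k else 0 := by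
    intro k
    have h2 : ∑ i, M l i * N i k = if l = k then 1 else 0 := by
      rw [← Matrix.mul_apply, h, Matrix.one_apply]
    have h3 := congrArg (fun y => t k * φ y) h2
    simp only [map_sum, map_mul, Finset.mul_sum, apply_ite φ, map_one, map_zero, mul_ite, mul_one,
      mul_zero] at h3
    rw [← h3]
    exact Finset.sum_congr rfl fun i _ => by ring
  simp_rw [Finset.sum_mul]
  rw [Finset.sum_comm]
  simp [h1]

/-! ### The maximal ideal and residue field of the local ring at a point. -/

section LocalRing

variable {K : Type*} [Field K] {n : ℕ} {W : Set (Fin n → K)} {p : W}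

theorem toLocal_C (a : K) : toLocal W p (C a) = algebraMap K (LocalRingAt W p) a := rfl

theorem coe_coordGerm (i : Fin n) : (coordGerm W p i : LocalRingAt W p) =
    toLocal W p (X i) - algebraMap K _ ((p : Fin n → K) i) := by
  rw [← toLocal_C, ← map_sub]
  rfl

theorem toLocal_eq_aeval (g : MvPolynomial (Fin n) K) :
    toLocal W p g = aeval (fun i => toLocal W p (X i)) g := by
  have : toLocal W p = (aeval (R := K) fun i => toLocal W p (X i)).toRingHom := by
    refine MvPolynomial.ringHom_ext (fun a => ?_) fun i => ?_
    · rw [toLocal_C]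
      simp
    · simp
  exact congrArg (· g) this

theorem toLocal_sub_eval_mem_span (g : MvPolynomial (Fin n) K) :
    toLocal W p g - algebraMap K _ (aeval (p : Fin n → K) g) ∈
      Ideal.span (Set.range fun i => (coordGerm W p i : LocalRingAt W p)) := by
  have h := aeval_sub_aeval_mem (R := K)
    (Ideal.span (Set.range fun i => (coordGerm W p i : LocalRingAt W p)))
    (v := fun i => toLocal W p (X i)) (w := fun i => algebraMap K _ ((p : Fin n → K) i))
    (fun i => Ideal.subset_span ⟨i, coe_coordGerm i⟩) g
  have h1 := aeval_algebraMap_apply (LocalRingAt W p) (p : Fin n → K) g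
  rw [← toLocal_eq_aeval] at h
  exact h1 ▸ h

theorem span_coordGerm_le :
    Ideal.span (Set.range fun i => (coordGerm W p i : LocalRingAt W p)) ≤
      IsLocalRing.maximalIdeal (LocalRingAt W p) := by
  rw [Ideal.span_le]
  rintro _ ⟨i, rfl⟩
  exact (coordGerm W p i).2

theorem toLocal_mem_span_coordGerm {g : MvPolynomial (Fin n) K}
    (hg : aeval (p : Fin n → K) g = 0) :
    toLocal W p g ∈ Ideal.span (Set.range fun i => (coordGerm W p i : LocalRingAt W p)) := by
  simpa [hg] using toLocal_sub_eval_mem_span (W := W) (p := p) g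

theorem exists_toLocal_mul_eq (o : LocalRingAt W p) :
    ∃ g s : MvPolynomial (Fin n) K, aeval (p : Fin n → K) s ≠ 0 ∧
      o * toLocal W p s = toLocal W p g := by
  obtain ⟨⟨g, s⟩, h⟩ := IsLocalization.surj (pointIdeal W p).primeCompl o
  obtain ⟨g, rfl⟩ := Ideal.Quotient.mk_surjective g
  obtain ⟨s, hs⟩ := s
  obtain ⟨s, rfl⟩ := Ideal.Quotient.mk_surjective s
  exact ⟨g, s, fun h0 => hs (by simpa [evalAt, RingHom.mem_ker] using h0), h⟩

theorem isUnit_toLocal {s : MvPolynomial (Fin n) K} (hs : aeval (p : Fin n → K) s ≠ 0) :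
    IsUnit (toLocal W p s) :=
  toLocal_isUnit W p s hs

/-- The constant is the value `g(p)/s(p)` of a fraction `g/s`. The span is used instead of `𝔪`
because `span_coordGerm` is deduced from this. -/
theorem exists_sub_algebraMap_mem (o : LocalRingAt W p) : ∃ a : K,
    o - algebraMap K _ a ∈
      Ideal.span (Set.range fun i => (coordGerm W p i : LocalRingAt W p)) := by
  obtain ⟨g, s, hs, h⟩ := exists_toLocal_mul_eq o
  refine ⟨aeval (p : Fin n → K) g / aeval (p : Fin n → K) s, ?_⟩
  rw [← Ideal.mul_unit_mem_iff_mem _ (isUnit_toLocal hs), sub_mul, h, ← toLocal_C, ← map_mul,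
    ← map_sub]
  refine toLocal_mem_span_coordGerm ?_
  rw [map_sub, map_mul, aeval_C, Algebra.algebraMap_self_apply, div_mul_cancel₀ _ hs, sub_self]

theorem span_coordGerm :
    Ideal.span (Set.range fun i => (coordGerm W p i : LocalRingAt W p)) =
      IsLocalRing.maximalIdeal (LocalRingAt W p) := by
  refine le_antisymm span_coordGerm_le fun o ho => ?_
  obtain ⟨a, ha⟩ := exists_sub_algebraMap_mem o
  have h1 : algebraMap K (LocalRingAt W p) a ∈ IsLocalRing.maximalIdeal (LocalRingAt W p) := by
    have := sub_mem ho (span_coordGerm_le ha)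
    rwa [sub_sub_cancel] at this
  have h2 : a = 0 := by
    by_contra h0
    exact (IsLocalRing.mem_maximalIdeal _).1 h1 ((IsUnit.mk0 a h0).map _)
  simpa [h2] using ha

theorem toLocal_eq_zero {g : MvPolynomial (Fin n) K} (hg : g ∈ vanishingIdeal K W) :
    toLocal W p g = 0 := by
  rw [toLocal, RingHom.comp_apply, Ideal.Quotient.eq_zero_iff_mem.2 hg, map_zero]

end LocalRing

/-! ### The first `d` coordinates as parameters: generation and independence. -/

section Parameters

variable {K : Type*} [Field K] {d r : ℕ} {W : Set (Fin (d + r) → K)}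
  {F : Fin r → MvPolynomial (Fin (d + r)) K} {p : W}

/-- The Jacobian block evaluated at a point. -/
def jacobianBlockAt (F : Fin r → MvPolynomial (Fin (d + r)) K) (a : Fin (d + r) → K) :
    Matrix (Fin r) (Fin r) K :=
  (jacobianBlock F).map (aeval a)

theorem jacobianBlockAt_apply (a : Fin (d + r) → K) (k i : Fin r) :
    jacobianBlockAt F a k i = aeval a (pderiv (Fin.natAdd d i) (F k)) := rfl

theorem isUnit_det_jacobianBlockAt {a : Fin (d + r) → K} (h : aeval a (minor F) ≠ 0) :
    IsUnit (jacobianBlockAt F a).det := by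
  have : (jacobianBlockAt F a).det = aeval a (minor F) := by
    rw [minor, AlgHom.map_det]
    rfl
  rw [this]
  exact IsUnit.mk0 _ h

theorem span_inducedParameters [IsNoetherianRing (LocalRingAt W p)]
    (hF : ∀ k, F k ∈ vanishingIdeal K W) (hp : aeval (p : Fin (d + r) → K) (minor F) ≠ 0) :
    Ideal.span (Set.range fun j => (inducedParameters W p j : LocalRingAt W p)) =
      IsLocalRing.maximalIdeal (LocalRingAt W p) := by
  set m := IsLocalRing.maximalIdeal (LocalRingAt W p) with hm
  set S := Ideal.span (Set.range fun j => (inducedParameters W p j : LocalRingAt W p)) with hS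
  set M := jacobianBlockAt F (p : Fin (d + r) → K) with hM
  have hSm : S ≤ m := by
    rw [hS, Ideal.span_le]
    rintro _ ⟨i, rfl⟩
    exact (inducedParameters W p i).2
  have hXS : ∀ j : Fin d, (coordGerm W p (Fin.castAdd r j) : LocalRingAt W p) ∈ S :=
    fun j => Ideal.subset_span ⟨j, rfl⟩
  -- Taylor expansion of `F k = 0` at `p`; the terms of the first `d` coordinates are absorbed in
  -- `S`.
  have hrow : ∀ k, ∑ i, (coordGerm W p (Fin.natAdd d i) : LocalRingAt W p) *
      algebraMap K _ (M k i) ∈ S ⊔ m ^ 2 := by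
    intro k
    have h := aeval_add_sub_linear_mem m
      (fun i => algebraMap K (LocalRingAt W p) ((p : Fin (d + r) → K) i))
      (δ := fun i => (coordGerm W p i : LocalRingAt W p)) (fun i => (coordGerm W p i).2) (F k)
    have h1 : ∀ i, algebraMap K (LocalRingAt W p) ((p : Fin (d + r) → K) i) +
        (coordGerm W p i : LocalRingAt W p) = toLocal W p (X i) := by
      intro i
      rw [coe_coordGerm]
      ring
    have h2 : ∀ g : MvPolynomial (Fin (d + r)) K,
        aeval (fun i => algebraMap K (LocalRingAt W p) ((p : Fin (d + r) → K) i)) g =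
          algebraMap K _ (aeval (p : Fin (d + r) → K) g) := by
      intro g
      rw [← aeval_algebraMap_apply]
      rfl
    have h3 : aeval (p : Fin (d + r) → K) (F k) = 0 := hF k p p.2
    simp only [h1, h2, ← toLocal_eq_aeval, toLocal_eq_zero (hF k), h3, map_zero, zero_add,
      zero_sub, neg_mem_iff, Fin.sum_univ_add] at h
    have h4 : ∑ j : Fin d, (coordGerm W p (Fin.castAdd r j) : LocalRingAt W p) *
        algebraMap K _ (aeval (p : Fin (d + r) → K) (pderiv (Fin.castAdd r j) (F k))) ∈ S :=
      sum_mem fun j _ => S.mul_mem_right _ (hXS j)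
    have := sub_mem (Ideal.mem_sup_right (S := S) h) (Ideal.mem_sup_left (T := m ^ 2) h4)
    rwa [add_sub_cancel_left] at this
  have hT : ∀ i, (coordGerm W p (Fin.natAdd d i) : LocalRingAt W p) ∈ S ⊔ m ^ 2 := by
    intro i
    have h : ∑ k, (∑ i', (coordGerm W p (Fin.natAdd d i') : LocalRingAt W p) *
        algebraMap K _ (M k i')) * algebraMap K _ (M⁻¹ i k) ∈ S ⊔ m ^ 2 :=
      sum_mem fun k _ => Ideal.mul_mem_right _ _ (hrow k)
    rwa [sum_sum_mul_eq_of_mul_eq_one _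
      (Matrix.nonsing_inv_mul _ (isUnit_det_jacobianBlockAt hp))] at h
  refine le_antisymm hSm ?_
  -- Nakayama reduces the claim to `m ≤ S ⊔ m²`.
  refine Submodule.le_of_le_smul_of_le_jacobson_bot (I := m) (IsNoetherian.noetherian _)
    (IsLocalRing.maximalIdeal_le_jacobson _) ?_
  rw [smul_eq_mul, ← pow_two]
  refine span_coordGerm.ge.trans (Ideal.span_le.2 ?_)
  rintro _ ⟨i, rfl⟩
  refine Fin.addCases (fun j => ?_) (fun j => ?_) i
  · exact Ideal.mem_sup_left (hXS j)
  · exact hT j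

/-- Approximate solutions of `F = 0` through a point at which the Jacobian block is invertible,
parametrized by the first `d` coordinates. -/
theorem exists_approximate_solution {a : Fin (d + r) → K}
    (ha : ∀ k, aeval a (F k) = 0) (h : aeval a (minor F) ≠ 0) (k : ℕ) :
    ∃ v : Fin (d + r) → MvPolynomial (Fin d) K,
      (∀ j, v (Fin.castAdd r j) = X j + C (a (Fin.castAdd r j))) ∧
      (∀ i, v i - C (a i) ∈ idealOfVars (Fin d) K) ∧
      ∀ l, aeval v (F l) ∈ idealOfVars (Fin d) K ^ (k + 1) := by
  set I := idealOfVars (Fin d) K with hI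
  set M := jacobianBlockAt F a with hM
  have hC : ∀ g : MvPolynomial (Fin (d + r)) K,
      aeval (fun i => (C (a i) : MvPolynomial (Fin d) K)) g = C (aeval a g) := by
    intro g
    have := aeval_algebraMap_apply (MvPolynomial (Fin d) K) a g
    exact this
  have hXI : ∀ j, X j ∈ I := fun j => Ideal.subset_span ⟨j, rfl⟩
  induction k with
  | zero =>
    -- To start, the last `r` coordinates are frozen at their values at `a`.
    refine ⟨Fin.append (fun j => X j + C (a (Fin.castAdd r j))) fun i => C (a (Fin.natAdd d i)),
      fun j => by simp, ?_, ?_⟩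
    · intro i
      refine Fin.addCases (fun j => ?_) (fun j => ?_) i
      · simpa using hXI j
      · simp
    · intro l
      rw [zero_add, pow_one]
      have := aeval_sub_aeval_mem (R := K) I
        (v := Fin.append (fun j => X j + C (a (Fin.castAdd r j))) fun i => C (a (Fin.natAdd d i)))
        (w := fun i => C (a i)) ?_ (F l)
      · rwa [hC, ha, map_zero, sub_zero] at this
      · intro i
        refine Fin.addCases (fun j => ?_) (fun j => ?_) i
        · simpa using hXI j
        · simp
  | succ k ih =>
    obtain ⟨v, hv1, hv2, hv3⟩ := ih
    -- Simplified Newton correction: the inverse Jacobian stays fixed at `a`, which still gains one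
    -- order per step.
    set ε : Fin r → MvPolynomial (Fin d) K := fun i => -∑ l, aeval v (F l) * C (M⁻¹ i l) with hε
    have hεI : ∀ i, ε i ∈ I ^ (k + 1) := fun i =>
      neg_mem (sum_mem fun l _ => Ideal.mul_mem_right _ _ (hv3 l))
    set δ : Fin (d + r) → MvPolynomial (Fin d) K := Fin.append (fun _ => 0) ε with hδ
    have hδI : ∀ i, δ i ∈ I ^ (k + 1) := by
      intro i
      refine Fin.addCases (fun j => ?_) (fun j => ?_) i
      · simp [hδ]
      · simpa [hδ] using hεI j
    refine ⟨fun i => v i + δ i, fun j => by simp [hδ, hv1], fun i => ?_, fun l => ?_⟩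
    · have := I.add_mem (hv2 i) (Ideal.pow_le_self (Nat.succ_ne_zero k) (hδI i))
      convert this using 1
      ring
    · have h1 := aeval_add_sub_linear_mem (R := K) (I ^ (k + 1)) v hδI (F l)
      rw [← pow_mul] at h1
      have h2 := Ideal.pow_le_pow_right (I := I) (show k + 1 + 1 ≤ (k + 1) * 2 by lia) h1
      -- Moving the derivatives from `v` to `a` changes them by elements of `I`, and `ε` supplies
      -- the factor in `I ^ (k + 1)`.
      have h3 : ∑ i, δ i * aeval v (pderiv i (F l)) - ∑ i, ε i * C (M l i) ∈ I ^ (k + 1 + 1) := by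
        rw [Fin.sum_univ_add]
        simp only [hδ, Fin.append_left, Fin.append_right, zero_mul, Finset.sum_const_zero,
          zero_add, ← Finset.sum_sub_distrib, ← mul_sub]
        refine sum_mem fun i _ => ?_
        rw [pow_succ]
        refine Ideal.mul_mem_mul (hεI i) ?_
        rw [hM, jacobianBlockAt_apply, ← hC]
        exact aeval_sub_aeval_mem I hv2 _
      have h4 : ∑ i, ε i * C (M l i) = -aeval v (F l) := by
        simp only [hε, neg_mul, Finset.sum_neg_distrib]
        rw [sum_sum_mul_eq_of_mul_eq_one (C (σ := Fin d) (R := K))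
          (Matrix.mul_nonsing_inv _ (isUnit_det_jacobianBlockAt h))]
      have := add_mem h2 h3
      rw [h4] at this
      convert this using 1
      ring

/-- An approximate solution induces a map from the local ring to truncated polynomials that sends
the parameters to the variables and `𝔪` into the variable ideal, whose top power is zero there. -/
theorem mem_pow_idealOfVars_of_aeval_mem
    (hF : vanishingIdeal K W = Ideal.span (Set.range F))
    (hp : aeval (p : Fin (d + r) → K) (minor F) ≠ 0) (k : ℕ) (P : MvPolynomial (Fin d) K)
    (hP : aeval (fun j => (inducedParameters W p j : LocalRingAt W p)) P ∈
      IsLocalRing.maximalIdeal (LocalRingAt W p) ^ k) :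
    P ∈ idealOfVars (Fin d) K ^ k := by
  obtain _ | k := k
  · simp
  have hFW : ∀ l, F l ∈ vanishingIdeal K W := fun l => hF ▸ Ideal.subset_span ⟨l, rfl⟩
  obtain ⟨v, hv1, hv2, hv3⟩ := exists_approximate_solution (F := F) (fun l => hFW l p p.2) hp k
  set I := idealOfVars (Fin d) K with hI
  let q : MvPolynomial (Fin d) K →+* MvPolynomial (Fin d) K ⧸ I ^ (k + 1) := Ideal.Quotient.mk _
  have hv4 : ∀ g : MvPolynomial (Fin (d + r)) K,
      aeval v g - C (aeval (p : Fin (d + r) → K) g) ∈ I := by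
    intro g
    have h1 := aeval_sub_aeval_mem I hv2 g
    have h2 := aeval_algebraMap_apply (MvPolynomial (Fin d) K) (p : Fin (d + r) → K) g
    exact h2 ▸ h1
  have hq : ∀ g ∈ I, IsNilpotent (q g) := fun g hg =>
    ⟨k + 1, by rw [← map_pow]; exact Ideal.Quotient.eq_zero_iff_mem.2 (Ideal.pow_mem_pow hg _)⟩
  let φ : CoordRing W →+* MvPolynomial (Fin d) K ⧸ I ^ (k + 1) :=
    Ideal.Quotient.lift (vanishingIdeal K W) (q.comp (aeval v).toRingHom) (by
      intro g hg
      rw [hF] at hg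
      refine (Ideal.span_le (I := RingHom.ker (q.comp (aeval v).toRingHom))).2 ?_ hg
      rintro _ ⟨l, rfl⟩
      exact Ideal.Quotient.eq_zero_iff_mem.2 (hv3 l))
  have hφ : ∀ g, φ (Ideal.Quotient.mk _ g) = q (aeval v g) := fun g => rfl
  -- The image is the nonzero constant `s(p)` plus a nilpotent.
  have hunit : ∀ s : (pointIdeal W p).primeCompl, IsUnit (φ s) := by
    rintro ⟨s, hs⟩
    obtain ⟨s, rfl⟩ := Ideal.Quotient.mk_surjective s
    have hs0 : aeval (p : Fin (d + r) → K) s ≠ 0 :=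
      fun h0 => hs (by simpa [evalAt, RingHom.mem_ker] using h0)
    have h1 : IsUnit (q (C (aeval (p : Fin (d + r) → K) s))) :=
      ((IsUnit.mk0 _ hs0).map C).map q
    have h2 := hq _ (hv4 s)
    rw [map_sub] at h2
    have h3 := h2.isUnit_add_left_of_commute h1 (Commute.all _ _)
    rwa [add_sub_cancel] at h3
  let ψ : LocalRingAt W p →+* MvPolynomial (Fin d) K ⧸ I ^ (k + 1) :=
    IsLocalization.lift (M := (pointIdeal W p).primeCompl) hunit
  have hψ : ∀ g, ψ (toLocal W p g) = q (aeval v g) := fun g =>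
    IsLocalization.lift_eq hunit (Ideal.Quotient.mk _ g)
  have hψt : ∀ i, ψ (coordGerm W p i) = q (v i - C ((p : Fin (d + r) → K) i)) := by
    intro i
    rw [coordGerm, hψ]
    simp
  have hψm : IsLocalRing.maximalIdeal (LocalRingAt W p) ≤ (I.map q).comap ψ := by
    rw [← span_coordGerm, Ideal.span_le]
    rintro _ ⟨i, rfl⟩
    rw [SetLike.mem_coe, Ideal.mem_comap, hψt]
    exact Ideal.mem_map_of_mem q (hv2 i)
  have h0 : ψ (aeval (fun j => (inducedParameters W p j : LocalRingAt W p)) P) = 0 := by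
    have h1 := Ideal.pow_right_mono hψm (k + 1) hP
    have h2 := Ideal.le_comap_pow ψ (k + 1) h1
    rw [← Ideal.map_pow, Ideal.mem_comap] at h2
    have h3 : (I ^ (k + 1)).map q = ⊥ := Ideal.map_quotient_self _
    rw [h3] at h2
    exact h2
  have h1 : ψ.comp (aeval (R := K)
      fun j => (inducedParameters W p j : LocalRingAt W p)).toRingHom = q := by
    refine MvPolynomial.ringHom_ext (fun a => ?_) fun j => ?_
    · have h2 := hψ (C a)
      rw [toLocal_C, aeval_C] at h2
      simpa using h2
    · have h2 := hψt (Fin.castAdd r j)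
      rw [hv1, add_sub_cancel_right] at h2
      simpa [inducedParameters] using h2
  have h2 : q P = 0 := by
    rw [← h1]
    exact h0
  exact Ideal.Quotient.eq_zero_iff_mem.1 h2

end Parameters

/-! ### Derivations and the chain rule on the completion. -/

section Derivative

variable {K O ι : Type*} [Field K] [CommRing O] [IsLocalRing O] [Algebra K O] [Fintype ι]
  {x : ι → IsLocalRing.maximalIdeal O}

theorem completionDeriv_cohenMap (hΦ : Function.Injective (cohenMap K x)) (j : ι)
    (G : MvPowerSeries ι K) :
    completionDeriv K x j (cohenMap K x G) = cohenMap K x (MvPowerSeries.pderiv K j G) := by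
  rw [completionDeriv, Function.leftInverse_invFun hΦ]

theorem completionDeriv_add (hΦ : Function.Bijective (cohenMap K x)) (j : ι)
    (a b : Completion O) :
    completionDeriv K x j (a + b) = completionDeriv K x j a + completionDeriv K x j b := by
  obtain ⟨a, rfl⟩ := hΦ.2 a
  obtain ⟨b, rfl⟩ := hΦ.2 b
  simp only [← map_add, completionDeriv_cohenMap hΦ.1]

theorem completionDeriv_mul (hΦ : Function.Bijective (cohenMap K x)) (j : ι)
    (a b : Completion O) :
    completionDeriv K x j (a * b) =
      a * completionDeriv K x j b + b * completionDeriv K x j a := by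
  obtain ⟨a, rfl⟩ := hΦ.2 a
  obtain ⟨b, rfl⟩ := hΦ.2 b
  rw [← map_mul]
  simp only [completionDeriv_cohenMap hΦ.1]
  rw [Derivation.leibniz, map_add, smul_eq_mul, smul_eq_mul, map_mul, map_mul]

theorem completionDeriv_algebraMap_aeval (hΦ : Function.Injective (cohenMap K x)) (j : ι)
    (P : MvPolynomial ι K) :
    completionDeriv K x j (algebraMap O (Completion O) (aeval (fun i => (x i : O)) P)) =
      algebraMap O (Completion O) (aeval (fun i => (x i : O)) (pderiv j P)) := by
  rw [← cohenMap_coe, completionDeriv_cohenMap hΦ, MvPowerSeries.pderiv_coe, cohenMap_coe]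

/-- The chain rule for the composition of a polynomial with elements of the completion. -/
theorem completionDeriv_eval₂ {σ : Type*} [Fintype σ] (hΦ : Function.Bijective (cohenMap K x))
    (j : ι) (v : σ → Completion O) (g : MvPolynomial σ K) :
    completionDeriv K x j
        (eval₂ ((algebraMap O (Completion O)).comp (algebraMap K O)) v g) =
      ∑ l, eval₂ ((algebraMap O (Completion O)).comp (algebraMap K O)) v (pderiv l g) *
        completionDeriv K x j (v l) := by
  classical
  induction g using MvPolynomial.induction_on with
  | C a =>
    have := completionDeriv_algebraMap_aeval hΦ.1 j (C a)
    simpa using this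
  | add p q hp hq =>
    simp only [eval₂_add, completionDeriv_add hΦ, hp, hq, map_add, add_mul,
      Finset.sum_add_distrib]
  | mul_X p i hp =>
    have h1 : ∀ l, eval₂ ((algebraMap O (Completion O)).comp (algebraMap K O)) v
        (pderiv l (p * X i)) * completionDeriv K x j (v l) =
        (if i = l then eval₂ ((algebraMap O (Completion O)).comp (algebraMap K O)) v p *
          completionDeriv K x j (v l) else 0) +
        v i * (eval₂ ((algebraMap O (Completion O)).comp (algebraMap K O)) v (pderiv l p) *
          completionDeriv K x j (v l)) := by
      intro l
      rw [Derivation.leibniz, pderiv_X, Pi.single_apply]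
      simp only [smul_eq_mul, eval₂_add, eval₂_mul, eval₂_X]
      split_ifs <;> simp <;> ring
    rw [eval₂_mul, eval₂_X, completionDeriv_mul hΦ, hp, Finset.sum_congr rfl fun l _ => h1 l,
      Finset.sum_add_distrib, Finset.mul_sum]
    simp

end Derivative

/-! ### Comparison of the two ideals. -/

section Delta

variable {K : Type*} [Field K] {d r : ℕ} {W : Set (Fin (d + r) → K)}
  {F : Fin r → MvPolynomial (Fin (d + r)) K} {p : W}

variable (W p) in
/-- The image of a polynomial in the completion of `𝒪_{W,p}`. -/
def toCompletion : MvPolynomial (Fin (d + r)) K →+* Completion (LocalRingAt W p) :=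
  (algebraMap (LocalRingAt W p) (Completion (LocalRingAt W p))).comp (toLocal W p)

theorem completionDeriv_toCompletion
    (hΦ : Function.Bijective (cohenMap K (inducedParameters W p))) (j : Fin d)
    (g : MvPolynomial (Fin (d + r)) K) :
    completionDeriv K (inducedParameters W p) j (toCompletion W p g) =
      ∑ l, toCompletion W p (pderiv l g) *
        completionDeriv K (inducedParameters W p) j (toCompletion W p (X l)) := by
  have h : ∀ g, toCompletion W p g =
      eval₂ ((algebraMap (LocalRingAt W p) (Completion (LocalRingAt W p))).comp
        (algebraMap K (LocalRingAt W p))) (fun l => toCompletion W p (X l)) g := by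
    intro g
    rw [toCompletion, RingHom.comp_apply, toLocal_eq_aeval, aeval_def, hom_eval₂]
    rfl
  rw [h g, completionDeriv_eval₂ hΦ]
  exact Finset.sum_congr rfl fun l _ => by rw [← h]

theorem completionDeriv_toCompletion_X
    (hΦ : Function.Bijective (cohenMap K (inducedParameters W p))) (i j : Fin d) :
    completionDeriv K (inducedParameters W p) j (toCompletion W p (X (Fin.castAdd r i))) =
      if i = j then 1 else 0 := by
  have h := completionDeriv_algebraMap_aeval (x := inducedParameters W p) hΦ.1 j
    (X i + C ((p : Fin (d + r) → K) (Fin.castAdd r i)))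
  have h1 : aeval (fun j => (inducedParameters W p j : LocalRingAt W p))
      (X i + C ((p : Fin (d + r) → K) (Fin.castAdd r i))) =
      toLocal W p (X (Fin.castAdd r i)) := by
    rw [map_add, aeval_X, aeval_C, inducedParameters, coe_coordGerm, sub_add_cancel]
  rw [h1] at h
  refine h.trans ?_
  rw [map_add, pderiv_C, pderiv_X, Pi.single_apply, add_zero]
  split_ifs <;> simp_all

/-- Carries the row reduction congruences from `W ∩ D(h)` to the completion at `p`. -/
theorem toCompletion_sub_mem {h f a b : MvPolynomial (Fin (d + r)) K}
    (hp : aeval (p : Fin (d + r) → K) h ≠ 0)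
    (hab : toRegularMod W h f a = toRegularMod W h f b) :
    toCompletion W p a - toCompletion W p b ∈ Ideal.span {toCompletion W p f} := by
  have h1 := Ideal.Quotient.eq.1 hab
  have hg : ∀ g, germ W h p hp (toRegular W h g) = toLocal W p g := fun g =>
    IsLocalization.Away.lift_eq _ _ _
  have h2 := Ideal.mem_map_of_mem
    ((algebraMap (LocalRingAt W p) (Completion (LocalRingAt W p))).comp (germ W h p hp)) h1
  rw [Ideal.map_span, Set.image_singleton, map_sub] at h2
  simp only [RingHom.comp_apply, hg] at h2
  exact h2

theorem toCompletion_tildef (hF : ∀ k, F k ∈ vanishingIdeal K W) (f : MvPolynomial (Fin (d + r)) K)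
    (c : Fin r → MvPolynomial (Fin (d + r)) K) :
    toCompletion W p (tildef F f c) = toCompletion W p (minor F) * toCompletion W p f := by
  have h1 : ∀ k, toCompletion W p (F k) = 0 := fun k => by
    rw [toCompletion, RingHom.comp_apply, toLocal_eq_zero (hF k), map_zero]
  simp [tildef, tildeF, Matrix.mulVec, dotProduct, h1]

/-- In the completion, `H_j` agrees with `h ∂f/∂X_j` modulo `f`. -/
theorem minor_mul_completionDeriv_sub_mem
    (hΦ : Function.Bijective (cohenMap K (inducedParameters W p)))
    (hF : ∀ k, F k ∈ vanishingIdeal K W) (hp : aeval (p : Fin (d + r) → K) (minor F) ≠ 0)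
    {f : MvPolynomial (Fin (d + r)) K} {c : Fin r → MvPolynomial (Fin (d + r)) K}
    {H : Fin d → MvPolynomial (Fin (d + r)) K} (hH : IsRowReduction W F f c H) (j : Fin d) :
    toCompletion W p (minor F) *
        completionDeriv K (inducedParameters W p) j (toCompletion W p f) -
      toCompletion W p (H j) ∈ Ideal.span {toCompletion W p f} := by
  have h1 := completionDeriv_toCompletion hΦ j (tildef F f c)
  rw [toCompletion_tildef hF, completionDeriv_mul hΦ, Fin.sum_univ_add] at h1
  simp only [completionDeriv_toCompletion_X hΦ, mul_ite, mul_one, mul_zero, Finset.sum_ite_eq',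
    Finset.mem_univ, if_true] at h1
  have h2 := toCompletion_sub_mem hp (hH.left j)
  -- The derivatives of the dependent coordinates need not be computed, since their coefficients
  -- vanish modulo `f`.
  have h3 : ∑ i, toCompletion W p (pderiv (Fin.natAdd d i) (tildef F f c)) *
      completionDeriv K (inducedParameters W p) j (toCompletion W p (X (Fin.natAdd d i))) ∈
        Ideal.span {toCompletion W p f} := by
    refine sum_mem fun i _ => Ideal.mul_mem_right _ _ ?_
    have := toCompletion_sub_mem (b := 0) hp ((hH.right i).trans (map_zero _).symm)
    rwa [map_zero, sub_zero] at this
  -- The remaining Leibniz term `f * D_j h` of `D_j (h f)`.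
  have h4 := Ideal.mul_mem_right
    (completionDeriv K (inducedParameters W p) j (toCompletion W p (minor F))) _
    (Ideal.mem_span_singleton_self (toCompletion W p f))
  have h5 := sub_mem (add_mem h2 h3) h4
  convert h5 using 1
  linear_combination h1

theorem map_delta_eq_span {h : MvPolynomial (Fin (d + r)) K}
    (hp : aeval (p : Fin (d + r) → K) h ≠ 0) (f : MvPolynomial (Fin (d + r)) K)
    (H : Fin d → MvPolynomial (Fin (d + r)) K) :
    ((delta W h f H).map (germ W h p hp)).map
        (algebraMap (LocalRingAt W p) (Completion (LocalRingAt W p))) =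
      Ideal.span ({toCompletion W p f} ∪ Set.range fun j => toCompletion W p (H j)) := by
  have hg : ∀ g, germ W h p hp (toRegular W h g) = toLocal W p g := fun g =>
    IsLocalization.Away.lift_eq _ _ _
  rw [delta, Ideal.map_span, Ideal.map_span, Set.image_union, Set.image_union,
    Set.image_singleton, Set.image_singleton, ← Set.range_comp, ← Set.range_comp]
  simp only [Function.comp_def, hg]
  rfl

theorem span_union_range_eq_of_mul_sub_mem {A κ : Type*} [CommRing A] {u a : A} (hu : IsUnit u)
    {x y : κ → A} (h : ∀ j, u * x j - y j ∈ Ideal.span {a}) :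
    Ideal.span ({a} ∪ Set.range y) = Ideal.span ({a} ∪ Set.range x) := by
  have ha : ∀ z : κ → A, Ideal.span {a} ≤ Ideal.span ({a} ∪ Set.range z) :=
    fun z => Ideal.span_mono Set.subset_union_left
  have hz : ∀ (z : κ → A) j, z j ∈ Ideal.span ({a} ∪ Set.range z) :=
    fun z j => Ideal.subset_span (Or.inr ⟨j, rfl⟩)
  refine le_antisymm (Ideal.span_le.2 ?_) (Ideal.span_le.2 ?_)
  · rintro _ (rfl | ⟨j, rfl⟩)
    · exact Ideal.subset_span (Or.inl rfl)
    · have := sub_mem (Ideal.mul_mem_left _ u (hz x j)) (ha x (h j))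
      rwa [sub_sub_cancel] at this
  · rintro _ (rfl | ⟨j, rfl⟩)
    · exact Ideal.subset_span (Or.inl rfl)
    · have := add_mem (ha y (h j)) (hz y j)
      rw [sub_add_cancel] at this
      exact (Ideal.unit_mul_mem_iff_mem _ hu).1 this

end Delta

end ChainRule

end

theorem mainTheorem3 {K : Type*} [Field K] [IsAlgClosed K] {d r : ℕ}
    (W : Set (Fin (d + r) → K)) (F : Fin r → MvPolynomial (Fin (d + r)) K)
    (hW : ChainRule.IsSmoothCompleteIntersection W F)
    (f : MvPolynomial (Fin (d + r)) K) (hf : f ∉ vanishingIdeal K W)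
    (c : Fin r → MvPolynomial (Fin (d + r)) K) (H : Fin d → MvPolynomial (Fin (d + r)) K)
    (hH : ChainRule.IsRowReduction W F f c H)
    (p : W) (hp : aeval (p : Fin (d + r) → K) (ChainRule.minor F) ≠ 0) :
    ChainRule.IsRegularSystemOfParameters (ChainRule.inducedParameters W p) ∧
    Function.Bijective (ChainRule.cohenMap K (ChainRule.inducedParameters W p)) ∧
    ((ChainRule.delta W (ChainRule.minor F) f H).map
        (ChainRule.germ W (ChainRule.minor F) p hp)).map
        (algebraMap (ChainRule.LocalRingAt W p)
          (ChainRule.Completion (ChainRule.LocalRingAt W p))) =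
      ChainRule.localDelta K (ChainRule.inducedParameters W p)
        (algebraMap (ChainRule.LocalRingAt W p)
          (ChainRule.Completion (ChainRule.LocalRingAt W p)) (ChainRule.toLocal W p f)) := by
  have hF : ∀ k, F k ∈ vanishingIdeal K W := fun k =>
    hW.vanishingIdeal_eq ▸ Ideal.subset_span ⟨k, rfl⟩
  have hreg := hW.smooth p
  have hspan := ChainRule.span_inducedParameters hF hp
  have hres : ∀ o : ChainRule.LocalRingAt W p, ∃ a : K,
      o - algebraMap K _ a ∈ IsLocalRing.maximalIdeal (ChainRule.LocalRingAt W p) := fun o =>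
    (ChainRule.exists_sub_algebraMap_mem o).imp fun _ h => ChainRule.span_coordGerm_le h
  have hinj := ChainRule.mem_pow_idealOfVars_of_aeval_mem hW.vanishingIdeal_eq hp
  have hΦ : Function.Bijective (ChainRule.cohenMap K (ChainRule.inducedParameters W p)) :=
    ⟨ChainRule.cohenMap_injective hinj, ChainRule.cohenMap_surjective hspan hres hinj⟩
  -- Order two suffices for minimality, which concerns only `𝔪/𝔪²`; bijectivity of `Φ` takes all
  -- orders.
  refine ⟨⟨hreg, hspan, ChainRule.spanFinrank_maximalIdeal_eq_card hspan hres (hinj 2)⟩, hΦ, ?_⟩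
  rw [ChainRule.map_delta_eq_span]
  exact ChainRule.span_union_range_eq_of_mul_sub_mem
    ((ChainRule.isUnit_toLocal hp).map (algebraMap _ _))
    (ChainRule.minor_mul_completionDeriv_sub_mem hΦ hF hp hH)
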